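/- For $n\ge 0$ let $\mathfrak S_n$ be the set of permutations $\pi=\pi_1\pi_2\cdots\pi_n$ of $[n]=\{1,\dots,n\}$, and let $r\ge 1$ be an integer. Put $$\mathrm{rDes}(\pi)=\{i\in[n-1] : \pi_i\ge \pi_{i+1}+r\},\qquad \mathrm{rInv}(\pi)=\{(i,j) : i<j,\ \pi_j<\pi_i<\pi_j+r\},$$ $$\mathrm{rdes}(\pi)=|\mathrm{rDes}(\pi)|,\qquad \mathrm{rmaj}(\pi)=\sum_{i\in \mathrm{rDes}(\pi)} i+|\mathrm{rInv}(\pi)|.$$ Let $\mathrm{Excp}_r(\pi)=\{i\in[n] : \pi_i>i,\ \pi_i\ge r\}$, let $\mathrm{Exc}_r(\pi)$ be the subword of $\pi_1\cdots\pi_n$ formed by the letters at the places in $\mathrm{Excp}_r(\pi)$, and let $\mathrm{Nexc}_r(\pi)$ be the subword formed by the letters at the remaining places. With $\mathrm{inv}(w)$ the number of pairs $a<b$ with $w_a>w_b$ in a word $w$, put $$\mathrm{exc}_r(\pi)=|\{i : \pi_i>i\ge r\}|,\qquad \mathrm{den}_r(\pi)=\sum_{i\in\mathrm{Excp}_r(\pi)}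 i+\mathrm{inv}(\mathrm{Exc}_r(\pi))+\mathrm{inv}(\mathrm{Nexc}_r(\pi)).$$ **Theorem (Liu's conjecture).** For every $r\ge1$ the pair $(\mathrm{exc}_r,\mathrm{den}_r)$ is $r$-Euler-Mahonian; that is, for every $n\ge 0$, as polynomials in $t$ and $q$, $$\sum_{\pi\in\mathfrak S_n}t^{\mathrm{rdes}(\pi)}q^{\mathrm{rmaj}(\pi)}=\sum_{\pi\in\mathfrak S_n}t^{\mathrm{exc}_r(\pi)}q^{\mathrm{den}_r(\pi)}.$$ In particular (the case $r=1$, the Denert–Foata–Zeilberger theorem), for every $n\ge0$, $$\sum_{\pi\in\mathfrak S_n}t^{\mathrm{des}(\pi)}q^{\mathrm{maj}(\pi)}=\sum_{\pi\in\mathfrak S_n}t^{\mathrm{exc}(\pi)}q^{\mathrm{den}(\pi)},$$ where $\mathrm{des}(\pi)$ and $\mathrm{maj}(\pi)$ are the number and the sum of the $i\in[n-1]$ with $\pi_i>\pi_{i+1}$, $\mathrm{exc}(\pi)$ is the number of $i$ with $\pi_i>i$, and $\mathrm{den}(\pi)$ is the sum of these $i$ plus $\mathrm{inv}$ of the subword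 of letters at these places plus $\mathrm{inv}$ of the subword of letters at the other places. -/

import Mathlib

open Finset MvPolynomial

namespace RawlingsDenert

/-- A permutation statistic: a natural number attached to every permutation of
`{1, …, n}`, for every `n`. The permutations of `{1, …, n}` are modelled by
`Equiv.Perm (Fin n)`; the element `i : Fin n` stands for the integer `i + 1`. -/
abbrev PermStat : Type := ∀ n : ℕ, Equiv.Perm (Fin n) → ℕ

/-- The place (one-based index) named by `i : Fin n`. -/
def place {n : ℕ} (i : Fin n) : ℕ := (i : ℕ) + 1

/-- The letter `π_i` of the one-line notation, an integer in `{1, …, n}`. -/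
def letter {n : ℕ} (π : Equiv.Perm (Fin n)) (i : Fin n) : ℕ := (π i : ℕ) + 1

/-- `Inv(π)`: the inversion pairs `(i, j)`, that is `i < j` and `π_i > π_j`. -/
def Inv {n : ℕ} (π : Equiv.Perm (Fin n)) : Finset (Fin n × Fin n) :=
  {p | p.1 < p.2 ∧ letter π p.2 < letter π p.1}

/-- The inversion number of the word obtained from `π_1 π_2 ⋯ π_n` by keeping exactly the
letters at the places in `S`, in their order: the pairs of places `i < j`, both in `S`, with
`π_i > π_j`. -/
def invAt {n : ℕ} (π : Equiv.Perm (Fin n)) (S : Finset (Fin n)) : ℕ :=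
  #{p ∈ Inv π | p.1 ∈ S ∧ p.2 ∈ S}

/-- `Des(π)`: the places `i ≤ n - 1` with `π_i > π_{i+1}`. -/
def Des {n : ℕ} (π : Equiv.Perm (Fin n)) : Finset (Fin n) :=
  {i | ∃ j : Fin n, place j = place i + 1 ∧ letter π i > letter π j}

/-- The descent number. -/
def des : PermStat := fun _ π => #(Des π)

/-- The major index. -/
def maj : PermStat := fun _ π => ∑ i ∈ Des π, place i

/-- `Excp(π)`: the excedance places, `π_i > i`. -/
def Excp {n : ℕ} (π : Equiv.Perm (Fin n)) : Finset (Fin n) :=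
  {i | letter π i > place i}

/-- The excedance number. -/
def exc : PermStat := fun _ π => #(Excp π)

/-- Denert's statistic. -/
def den : PermStat := fun _ π =>
  ∑ i ∈ Excp π, place i + invAt π (Excp π) + invAt π (Excp π)ᶜ

/-- `rDes(π)`: the places `i ≤ n - 1` with `π_i ≥ π_{i+1} + r`. -/
def rDes (r : ℕ) {n : ℕ} (π : Equiv.Perm (Fin n)) : Finset (Fin n) :=
  {i | ∃ j : Fin n, place j = place i + 1 ∧ letter π i ≥ letter π j + r}

/-- `rInv(π)`: the inversion pairs `(i, j)` with `π_i < π_j + r`. -/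
def rInv (r : ℕ) {n : ℕ} (π : Equiv.Perm (Fin n)) : Finset (Fin n × Fin n) :=
  {p ∈ Inv π | letter π p.1 < letter π p.2 + r}

/-- The `r`-descent number. -/
def rdes (r : ℕ) : PermStat := fun _ π => #(rDes r π)

/-- The `r`-major index. -/
def rmaj (r : ℕ) : PermStat := fun _ π => ∑ i ∈ rDes r π, place i + #(rInv r π)

/-- `Excp_r(π)`: the `r`-level excedance places, `π_i > i` and `π_i ≥ r`. -/
def rExcp (r : ℕ) {n : ℕ} (π : Equiv.Perm (Fin n)) : Finset (Fin n) :=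
  {i | letter π i > place i ∧ letter π i ≥ r}

/-- The `r`-level excedance number `exc_r(π) = #{i : π_i > i ≥ r}`. -/
def excLevel (r : ℕ) : PermStat := fun _ π => #{i | letter π i > place i ∧ place i ≥ r}

/-- The `r`-level Denert statistic `den_r(π)`. -/
def denLevel (r : ℕ) : PermStat := fun _ π =>
  ∑ i ∈ rExcp r π, place i + invAt π (rExcp r π) + invAt π (rExcp r π)ᶜ

/-- `∑_{π ∈ 𝔖_n} t^{st₁ π} q^{st₂ π}` in `ℤ[t, q]`, with `t = X 0` and `q = X 1`. -/
noncomputable def genFun (st₁ st₂ : PermStat) (n : ℕ) : MvPolynomial (Fin 2) ℤ :=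
  ∑ π : Equiv.Perm (Fin n), X 0 ^ st₁ n π * X 1 ^ st₂ n π

/-- The pair `(st₁, st₂)` is Euler-Mahonian. -/
def IsEulerMahonian (st₁ st₂ : PermStat) : Prop :=
  ∀ n : ℕ, genFun st₁ st₂ n = genFun des maj n

/-- The pair `(st₁, st₂)` is `r`-Euler-Mahonian. -/
def IsREulerMahonian (r : ℕ) (st₁ st₂ : PermStat) : Prop :=
  ∀ n : ℕ, genFun st₁ st₂ n = genFun (rdes r) (rmaj r) n

end RawlingsDenert

namespace RawlingsDenert

/-! Put `r = m + 1`. Both sides satisfy, for `n ≥ m`, the recursion `(1 - q) A_{n+1}(t) = (1 - t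
q^(n+1)) A_n(t) - (1 - t) q^r A_n(tq)`. For `n < r` they agree permutation by permutation, since
both pairs reduce to `(0, inv)`. Cancelling `1 - q` in a domain finishes the induction.

For `(rdes, rmaj)` the recursion comes from inserting the largest letter
(`sum_rdes_rmaj_recursion`). Of the `n + 1` positions, `rdes + r` keep `rdes` and raise `rmaj` by
`0, 1, 2, …`; the others raise `rdes` by one and continue the sequence of increments up to `n`.

For `(exc_r, den_r)` a permutation is a full rook placement, grown from a board with `m` values and
no places: add the first `m` places, then alternately a value and a place. A rook on a new value
fills an open place and is rising; a rook put on a new place is not. A place left open is certain to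
become rising, so its weight is paid at once. Inversions never need to be compared across the two
classes, so each rook contributes its rank among the open places or values.

The resulting recursion runs over the number `h` of open places, with only `h = 0` wanted. After
normalisation by `[h]_q!`, the generating series in `h` satisfies a `q`-difference equation relating
`t` and `tq` (`heightSeries_functional_eq`), and its coefficient of `x` is the recursion above
(`height_zero_recursion`). -/

/-- The `q`-integer `1 + q + ⋯ + q^(k-1)`. -/
def qInt {K : Type*} [CommRing K] (q : K) (k : ℕ) : K := ∑ i ∈ range k, q ^ i

section QInt

variable {K : Type*} [CommRing K] (q : K)

@[simp] lemma qInt_one : qInt q 1 = 1 := by simp [qInt]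

lemma one_sub_mul_qInt (k : ℕ) : (1 - q) * qInt q k = 1 - q ^ k :=
  mul_neg_geom_sum q k

/-- Ranking the elements of a finite set from the left. -/
lemma sum_pow_card_filter_lt {α : Type*} [LinearOrder α] (S : Finset α) :
    ∑ j ∈ S, q ^ #{i ∈ S | i < j} = qInt q #S := by
  induction S using Finset.induction_on_max with
  | empty => simp [qInt]
  | insert a s ha ih =>
    have has : a ∉ s := fun h => lt_irrefl _ (ha a h)
    rw [sum_insert has, card_insert_of_notMem has, qInt, sum_range_succ, ← qInt, ← ih, add_comm]
    congr 1
    · refine sum_congr rfl fun j hj => ?_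
      rw [filter_insert, if_neg (not_lt.2 (ha j hj).le)]
    · rw [filter_insert, if_neg (lt_irrefl a), filter_true_of_mem ha]

/-- Ranking the elements of a finite set from the right. -/
lemma sum_pow_card_filter_gt {α : Type*} [LinearOrder α] (S : Finset α) :
    ∑ j ∈ S, q ^ #{i ∈ S | j < i} = qInt q #S :=
  sum_pow_card_filter_lt (α := αᵒᵈ) q S

end QInt

/-! ### The weighted height recursion and its `q`-difference equation. -/

section HeightRecursion

open PowerSeries

variable {K : Type*} [CommRing K] {q : K} {m : ℕ} {F : ℕ → K → ℕ → K}

/-- The generating function of the heights, times `1 + x`. -/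
noncomputable def heightSeries (F : ℕ → K → ℕ → K) (n : ℕ) (t : K) : K⟦X⟧ :=
  (1 + PowerSeries.X) * PowerSeries.mk (F n t)

lemma coeff_zero_heightSeries (n : ℕ) (t : K) :
    PowerSeries.coeff 0 (heightSeries F n t) = F n t 0 := by
  simp [heightSeries, add_mul]

lemma coeff_succ_heightSeries (n : ℕ) (t : K) (h : ℕ) :
    PowerSeries.coeff (h + 1) (heightSeries F n t) = F n t (h + 1) + F n t h := by
  simp [heightSeries, add_mul, PowerSeries.coeff_succ_X_mul]

/-- Since `(1 - q) [k]_q = 1 - q^k`, multiplying the coefficient of `x^k` by `[k]_q` is, up to `1 -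
q`, the operator `S(x) ↦ S(x) - S(qx)`. -/
lemma one_sub_mul_heightSeries_succ
    (step_zero : ∀ n, m ≤ n → ∀ t, F (n + 1) t 0 = F n t 0 + F n t 1)
    (step_succ : ∀ n, m ≤ n → ∀ t h, F (n + 1) t (h + 1) =
      qInt q (h + 2) * (F n t (h + 1) + F n t (h + 2)) +
        t * q ^ (n + 1) * qInt q (h + 1) * (F n t h + F n t (h + 1)))
    (n : ℕ) (hn : m ≤ n) (t : K) :
    PowerSeries.C (1 - q) * PowerSeries.X * heightSeries F (n + 1) t =
      (1 + PowerSeries.X) * (1 + PowerSeries.C (t * q ^ (n + 1)) * PowerSeries.X) *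
        (heightSeries F n t - rescale q (heightSeries F n t)) := by
  have key : PowerSeries.C (1 - q) * PowerSeries.X * PowerSeries.mk (F (n + 1) t) =
      (1 + PowerSeries.C (t * q ^ (n + 1)) * PowerSeries.X) *
        (heightSeries F n t - rescale q (heightSeries F n t)) := by
    ext h
    generalize hc : 1 - q = c
    rw [add_mul, one_mul, mul_assoc, mul_assoc]
    rcases h with _ | _ | h
    · simp only [map_add, map_sub, coeff_rescale, PowerSeries.coeff_C_mul, coeff_zero_X_mul,
        coeff_zero_heightSeries]
      ring
    · simp only [map_add, map_sub, coeff_rescale, PowerSeries.coeff_C_mul, coeff_succ_X_mul, coeff_zero_heightSeries,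
        coeff_succ_heightSeries,
        coeff_mk, zero_add, step_zero n hn]
      rw [← hc]
      ring
    · simp only [map_add, map_sub, coeff_rescale, PowerSeries.coeff_C_mul, coeff_succ_X_mul,
        coeff_succ_heightSeries,
        coeff_mk, step_succ n hn]
      rw [← hc]
      linear_combination (F n t (h + 1) + F n t (h + 2)) * one_sub_mul_qInt q (h + 2) +
        t * q ^ (n + 1) * (F n t h + F n t (h + 1)) * one_sub_mul_qInt q (h + 1)
  rw [heightSeries]
  linear_combination (1 + PowerSeries.X) * key

variable [IsDomain K]

/-- The recursion alone gives `S_{n+1}` through `S_n(qx)`. This equation replaces that term by the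
shift `t ↦ tq`, and the recursion step preserves it. -/
lemma heightSeries_functional_eq (hq : q ≠ 1)
    (base_const : ∀ t t' h, F m t h = F m t' h)
    (base_ratio : ∀ t h, (1 - q ^ (h + 1)) * F m t (h + 1) =
      (q ^ (h + 1) - q ^ (m + 1)) * F m t h)
    (step_zero : ∀ n, m ≤ n → ∀ t, F (n + 1) t 0 = F n t 0 + F n t 1)
    (step_succ : ∀ n, m ≤ n → ∀ t h, F (n + 1) t (h + 1) =
      qInt q (h + 2) * (F n t (h + 1) + F n t (h + 2)) +
        t * q ^ (n + 1) * qInt q (h + 1) * (F n t h + F n t (h + 1)))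
    (n : ℕ) (hn : m ≤ n) : ∀ t : K,
    (1 + PowerSeries.X) * (heightSeries F n t - rescale q (heightSeries F n t)) =
      PowerSeries.X * (PowerSeries.C (1 - t * q ^ (n + 1)) * heightSeries F n t -
        PowerSeries.C ((1 - t) * q ^ (m + 1)) * heightSeries F n (t * q)) := by
  have hq' : PowerSeries.C (1 - q) ≠ 0 := by
    rw [Ne, map_eq_zero_iff _ PowerSeries.C_injective]
    exact sub_ne_zero.2 hq.symm
  induction n, hn using Nat.le_induction with
  | base =>
    intro t
    -- At `n = m` nothing depends on `t`, and `(1 - t q^(m+1)) - (1 - t) q^(m+1) = 1 - q^(m+1)`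
    -- removes `t` from the equation.
    have h0 : heightSeries F m (t * q) = heightSeries F m t := by
      simp only [heightSeries]
      congr 2
      funext h
      exact base_const _ _ _
    have h1 : PowerSeries.mk (F m t) -
        (1 + PowerSeries.C q * PowerSeries.X) * rescale q (PowerSeries.mk (F m t)) =
        PowerSeries.X * PowerSeries.C (1 - q ^ (m + 1)) * PowerSeries.mk (F m t) -
        PowerSeries.X * PowerSeries.mk (F m t) := by
      ext h
      generalize hc : 1 - q ^ (m + 1) = c
      rw [add_mul, one_mul, mul_assoc, mul_assoc]
      cases h with
      | zero =>
        simp only [map_sub, map_add, coeff_rescale, PowerSeries.coeff_C_mul, coeff_zero_X_mul,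
          coeff_mk]
        ring
      | succ h =>
        simp only [map_add, map_sub, coeff_rescale, PowerSeries.coeff_C_mul, coeff_succ_X_mul,
          coeff_mk]
        rw [← hc]
        linear_combination base_ratio t h
    rw [h0, heightSeries]
    simp only [map_mul, map_add, map_one, rescale_X, map_sub, map_pow] at h1 ⊢
    linear_combination (1 + PowerSeries.X) * h1
  | succ n hn ih =>
    intro t
    set Y : K⟦X⟧ := PowerSeries.X with hY
    have hY0 : Y ≠ 0 := PowerSeries.X_ne_zero
    -- The induction hypothesis turns the difference in the one-step identity into a multiple of
    -- `x`, which cancels.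
    have e1 : ∀ t, PowerSeries.C (1 - q) * heightSeries F (n + 1) t =
        (1 + PowerSeries.C (t * q ^ (n + 1)) * Y) *
        (PowerSeries.C (1 - t * q ^ (n + 1)) * heightSeries F n t -
          PowerSeries.C ((1 - t) * q ^ (m + 1)) * heightSeries F n (t * q)) := by
      intro t
      apply mul_left_cancel₀ hY0
      linear_combination one_sub_mul_heightSeries_succ step_zero step_succ n hn t +
        (1 + PowerSeries.C (t * q ^ (n + 1)) * Y) * ih t
    have e2 := congrArg (rescale q) (e1 t)
    have rC : ∀ c : K, rescale q (PowerSeries.C c) = PowerSeries.C c := by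
      intro c
      ext k
      rw [coeff_rescale, PowerSeries.coeff_C]
      split_ifs with h
      · simp [h]
      · simp
    have rY : rescale q Y = PowerSeries.C q * Y := rescale_X q
    have e3 := e1 (t * q)
    have e4 := e1 t
    have i1 := ih t
    have i2 := ih (t * q)
    simp only [map_mul, map_sub, map_add, map_one, map_pow, rC, rY] at e2 e3 e4 i1 i2 ⊢
    simp only [map_sub, map_one] at hq'
    apply mul_left_cancel₀ hq'
    generalize heightSeries F n t = a at *
    generalize heightSeries F n (t * q) = b at *
    generalize heightSeries F n (t * q * q) = c at *
    generalize rescale q a = a' at *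
    generalize rescale q b = b' at *
    generalize heightSeries F (n + 1) t = u at *
    generalize heightSeries F (n + 1) (t * q) = v at *
    generalize rescale q u = u' at *
    generalize PowerSeries.C t = T at *
    generalize PowerSeries.C q = Q at *
    -- `e4`, `e2`, `e3` express the series at `n + 1` by those at `n`; `i1` and `i2` then eliminate
    -- the rescaled series.
    linear_combination (1 + Y - Y * (1 - T * Q ^ (n + 2))) * e4 - (1 + Y) * e2 +
      Y * (1 - T) * Q ^ (m + 1) * e3 +
      (1 + T * Q ^ (n + 2) * Y) * (1 - T * Q ^ (n + 1)) * i1 -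
      (1 + T * Q ^ (n + 2) * Y) * (1 - T) * Q ^ (m + 1) * i2

/-- A weighted path recursion on heights whose bottom entries obey the recursion of the
`r`-Euler-Mahonian polynomials, `r = m + 1`. -/
theorem height_zero_recursion (hq : q ≠ 1)
    (base_const : ∀ t t' h, F m t h = F m t' h)
    (base_ratio : ∀ t h, (1 - q ^ (h + 1)) * F m t (h + 1) =
      (q ^ (h + 1) - q ^ (m + 1)) * F m t h)
    (step_zero : ∀ n, m ≤ n → ∀ t, F (n + 1) t 0 = F n t 0 + F n t 1)
    (step_succ : ∀ n, m ≤ n → ∀ t h, F (n + 1) t (h + 1) =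
      qInt q (h + 2) * (F n t (h + 1) + F n t (h + 2)) +
        t * q ^ (n + 1) * qInt q (h + 1) * (F n t h + F n t (h + 1)))
    (n : ℕ) (hn : m ≤ n) (t : K) :
    (1 - q) * F (n + 1) t 0 =
      (1 - t * q ^ (n + 1)) * F n t 0 - (1 - t) * q ^ (m + 1) * F n (t * q) 0 := by
  -- In the coefficient of `x` the left side is `(1 - q)(F_0 + F_1)`, which is `(1 - q) F_{n+1,0}`
  -- by `step_zero`.
  have h := congrArg (PowerSeries.coeff (0 + 1))
    (heightSeries_functional_eq hq base_const base_ratio step_zero step_succ n hn t)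
  generalize hc : 1 - t * q ^ (n + 1) = c at h ⊢
  rw [add_mul, one_mul, map_add, coeff_succ_X_mul, coeff_succ_X_mul] at h
  simp only [map_sub, coeff_rescale, PowerSeries.coeff_C_mul, coeff_succ_heightSeries,
    coeff_zero_heightSeries] at h
  rw [step_zero n hn]
  linear_combination h

end HeightRecursion

/-! ### Rook placements and their growth by one value or one place. -/

/-- Sets of non-attacking rooks on the board with places `0, …, a - 1` and values
`0, …, b - 1`. -/
def rooks (a b : ℕ) : Finset (Finset (ℕ × ℕ)) :=
  {R ∈ (range a ×ˢ range b).powerset |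
    Set.InjOn Prod.fst (R : Set (ℕ × ℕ)) ∧ Set.InjOn Prod.snd (R : Set (ℕ × ℕ))}

/-- The places below `a` without a rook. -/
def openPlaces (a : ℕ) (R : Finset (ℕ × ℕ)) : Finset ℕ := range a \ R.image Prod.fst

/-- The values below `b` without a rook. -/
def openValues (b : ℕ) (R : Finset (ℕ × ℕ)) : Finset ℕ := range b \ R.image Prod.snd

section Rooks

variable {a b : ℕ} {R : Finset (ℕ × ℕ)}

lemma mem_rooks : R ∈ rooks a b ↔ (∀ x ∈ R, x.1 < a ∧ x.2 < b) ∧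
    (∀ x ∈ R, ∀ y ∈ R, x.1 = y.1 → x = y) ∧ (∀ x ∈ R, ∀ y ∈ R, x.2 = y.2 → x = y) := by
  simp only [rooks, mem_filter, mem_powerset, subset_iff, mem_product, mem_range, Set.InjOn,
    mem_coe]

lemma mem_openPlaces {p : ℕ} : p ∈ openPlaces a R ↔ p < a ∧ ∀ v, (p, v) ∉ R := by
  simp [openPlaces]

lemma mem_openValues {v : ℕ} : v ∈ openValues b R ↔ v < b ∧ ∀ p, (p, v) ∉ R := by
  simp [openValues]

lemma card_openPlaces (hR : R ∈ rooks a b) : #(openPlaces a R) + #R = a := by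
  obtain ⟨h, h1, h2⟩ := mem_rooks.1 hR
  have h3 : R.image Prod.fst ⊆ range a := by
    intro p hp
    obtain ⟨x, hx, rfl⟩ := mem_image.1 hp
    exact mem_range.2 (h x hx).1
  have h4 : #(R.image Prod.fst) = #R :=
    card_image_of_injOn fun x hx y hy => h1 x hx y hy
  have := card_le_card h3
  rw [openPlaces, card_sdiff_of_subset h3, ← h4]
  simp only [card_range] at *
  omega

lemma card_openValues (hR : R ∈ rooks a b) : #(openValues b R) + #R = b := by
  obtain ⟨h, h1, h2⟩ := mem_rooks.1 hR
  have h3 : R.image Prod.snd ⊆ range b := by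
    intro p hp
    obtain ⟨x, hx, rfl⟩ := mem_image.1 hp
    exact mem_range.2 (h x hx).2
  have h4 : #(R.image Prod.snd) = #R :=
    card_image_of_injOn fun x hx y hy => h2 x hx y hy
  have := card_le_card h3
  rw [openValues, card_sdiff_of_subset h3, ← h4]
  simp only [card_range] at *
  omega

variable {M : Type*} [AddCommMonoid M]

/-- A rook placement on a board with one more value is a placement on the smaller board,
possibly with a rook on the new value at an open place. -/
lemma sum_rooks_succ_right (f : Finset (ℕ × ℕ) → M) :
    ∑ R ∈ rooks a (b + 1), f R =
      ∑ R ∈ rooks a b, (f R + ∑ p ∈ openPlaces a R, f (insert (p, b) R)) := by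
  classical
  rw [sum_add_distrib, sum_sigma',
    ← sum_filter_add_sum_filter_not (rooks a (b + 1)) (fun R => ∀ p, (p, b) ∉ R)]
  congr 1
  · refine sum_congr ?_ fun _ _ => rfl
    ext R
    simp only [mem_filter, mem_rooks]
    constructor
    · rintro ⟨⟨h, h1, h2⟩, h3⟩
      refine ⟨fun x hx => ⟨(h x hx).1, ?_⟩, h1, h2⟩
      have h4 : x.2 ≠ b := by
        rintro rfl
        exact h3 x.1 hx
      have := (h x hx).2
      omega
    · rintro ⟨h, h1, h2⟩
      refine ⟨⟨fun x hx => ⟨(h x hx).1, (h x hx).2.trans (Nat.lt_succ_self b)⟩, h1, h2⟩, ?_⟩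
      intro p hp
      exact lt_irrefl _ (h _ hp).2
  · symm
    refine sum_bij (fun x _ => insert (x.2, b) x.1) ?_ ?_ ?_ ?_
    · rintro ⟨R, p⟩ hx
      simp only [mem_sigma, mem_openPlaces, mem_rooks, mem_filter] at hx ⊢
      obtain ⟨⟨h, h1, h2⟩, hp, hpR⟩ := hx
      refine ⟨⟨?_, ?_, ?_⟩, ?_⟩
      · intro x hx
        rcases mem_insert.1 hx with rfl | hx
        · exact ⟨hp, Nat.lt_succ_self b⟩
        · exact ⟨(h x hx).1, (h x hx).2.trans (Nat.lt_succ_self b)⟩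
      · intro x hx y hy hxy
        rcases mem_insert.1 hx with rfl | hx <;> rcases mem_insert.1 hy with rfl | hy
        · rfl
        · exact absurd hy (by obtain ⟨y1, y2⟩ := y; subst hxy; exact hpR _)
        · exact absurd hx (by obtain ⟨y1, y2⟩ := x; subst hxy; exact hpR _)
        · exact h1 x hx y hy hxy
      · intro x hx y hy hxy
        rcases mem_insert.1 hx with rfl | hx <;> rcases mem_insert.1 hy with rfl | hy
        · rfl
        · exact absurd (h y hy).2 (by rw [← hxy]; exact lt_irrefl _)
        · exact absurd (h x hx).2 (by rw [hxy]; exact lt_irrefl _)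
        · exact h2 x hx y hy hxy
      · intro h
        exact h p (mem_insert_self _ _)
    · rintro ⟨R, p⟩ hx ⟨R', p'⟩ hx' he
      simp only [mem_sigma, mem_openPlaces, mem_rooks] at hx hx' he
      have hR : (p, b) ∉ R := fun h => lt_irrefl _ (hx.1.1 _ h).2
      have hR' : ∀ p, (p, b) ∉ R' := fun p h => lt_irrefl _ (hx'.1.1 _ h).2
      have hp : p = p' := by
        have : (p, b) ∈ insert (p', b) R' := he ▸ mem_insert_self _ _
        rcases mem_insert.1 this with h | h
        · exact congrArg Prod.fst h
        · exact absurd h (hR' p)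
      subst hp
      have : R = R' := by
        rw [← erase_insert hR, he, erase_insert (hR' p)]
      subst this
      rfl
    · intro R hR
      simp only [mem_filter, mem_rooks, not_forall, not_not] at hR
      obtain ⟨⟨h, h1, h2⟩, p, hp⟩ := hR
      refine ⟨⟨R.erase (p, b), p⟩, ?_, insert_erase hp⟩
      simp only [mem_sigma, mem_openPlaces, mem_rooks]
      refine ⟨⟨?_, ?_, ?_⟩, (h _ hp).1, ?_⟩
      · intro x hx
        obtain ⟨hne, hx⟩ := mem_erase.1 hx
        refine ⟨(h x hx).1, lt_of_le_of_ne (Nat.lt_succ_iff.1 (h x hx).2) fun he => hne ?_⟩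
        exact h2 x hx _ hp he
      · exact fun x hx y hy => h1 x (mem_of_mem_erase hx) y (mem_of_mem_erase hy)
      · exact fun x hx y hy => h2 x (mem_of_mem_erase hx) y (mem_of_mem_erase hy)
      · intro v hv
        obtain ⟨hne, hv⟩ := mem_erase.1 hv
        exact hne (h1 _ hv _ hp rfl)
    · intros
      rfl

lemma image_swap_mem_rooks (hR : R ∈ rooks a b) : R.image Prod.swap ∈ rooks b a := by
  obtain ⟨h, h1, h2⟩ := mem_rooks.1 hR
  simp only [mem_rooks, forall_mem_image, Prod.fst_swap, Prod.snd_swap]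
  exact ⟨fun x hx => (h x hx).symm, fun x hx y hy e => congrArg _ (h2 x hx y hy e),
    fun x hx y hy e => congrArg _ (h1 x hx y hy e)⟩

lemma image_swap_image_swap : (R.image Prod.swap).image Prod.swap = R := by
  simp [image_image]

lemma sum_rooks_swap (f : Finset (ℕ × ℕ) → M) :
    ∑ R ∈ rooks a b, f R = ∑ R ∈ rooks b a, f (R.image Prod.swap) := by
  refine sum_bij' (fun R _ => R.image Prod.swap) (fun R _ => R.image Prod.swap)
    (fun R hR => image_swap_mem_rooks hR) (fun R hR => image_swap_mem_rooks hR)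
    (fun R _ => image_swap_image_swap) (fun R _ => image_swap_image_swap) fun R _ => ?_
  rw [image_swap_image_swap]

/-- A rook placement on a board with one more place is a placement on the smaller board,
possibly with a rook on the new place at an open value. -/
lemma sum_rooks_succ_left (f : Finset (ℕ × ℕ) → M) :
    ∑ R ∈ rooks (a + 1) b, f R =
      ∑ R ∈ rooks a b, (f R + ∑ v ∈ openValues b R, f (insert (a, v) R)) := by
  rw [sum_rooks_swap, sum_rooks_succ_right, sum_rooks_swap (a := a)]
  refine sum_congr rfl fun R _ => ?_
  congr 1
  refine sum_congr ?_ fun v _ => ?_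
  · simp [openPlaces, openValues, image_image, Function.comp_def]
  · rw [image_insert]
    rfl

lemma rooks_zero_left : rooks 0 b = {∅} := by
  ext R
  simp only [mem_rooks, mem_singleton]
  constructor
  · rintro ⟨h, -⟩
    exact eq_empty_of_forall_notMem fun x hx => absurd (h x hx).1 (Nat.not_lt_zero _)
  · rintro rfl
    simp

end Rooks

/-! ### Weights of rook placements and their recursions. -/

/-- The places below `a` that are open or carry a rook of value at least `m` above the
diagonal. -/
def risingPlaces (m a : ℕ) (R : Finset (ℕ × ℕ)) : Finset ℕ :=
  {p ∈ range a | ∀ v < max (p + 1) m, (p, v) ∉ R}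

/-- The number of inversions attributed to a rook at the time it is placed. -/
def rookInv (m : ℕ) (R : Finset (ℕ × ℕ)) (x : ℕ × ℕ) : ℕ :=
  if x.2 < max (x.1 + 1) m then #{u ∈ range x.2 | ∀ p ≤ x.1, (p, u) ∉ R}
  else #{p ∈ range x.1 | ∀ u ≤ x.2, (p, u) ∉ R}

section Weight

variable {K : Type*} [CommRing K] (q t : K) (m : ℕ)

/-- The weight of a rising place. -/
def placeWeight (p : ℕ) : K := (if m ≤ p then t else 1) * q ^ (p + 1)

/-- The weight of a rook placement with `a` places. -/
def rookWeight (a : ℕ) (R : Finset (ℕ × ℕ)) : K :=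
  (∏ p ∈ risingPlaces m a R, placeWeight q t m p) * q ^ ∑ x ∈ R, rookInv m R x

/-- The total weight of the rook placements with `h` open places. -/
def heightSum (a b h : ℕ) : K := ∑ R ∈ rooks a b with #R + h = a, rookWeight q t m a R

variable {m} {a b : ℕ} {R : Finset (ℕ × ℕ)}

/-- As `b` is at least `a` and `m`, the new rook is rising, so its place was already counted. Older
rooks look only at smaller values, so their inversion counts stay fixed. -/
lemma rookWeight_insert_right (hR : R ∈ rooks a b) (hab : a ≤ b) (hmb : m ≤ b) {p : ℕ}
    (hp : p ∈ openPlaces a R) :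
    rookWeight q t m a (insert (p, b) R) =
      rookWeight q t m a R * q ^ #{i ∈ openPlaces a R | i < p} := by
  obtain ⟨h, h1, h2⟩ := mem_rooks.1 hR
  obtain ⟨hpa, hpR⟩ := mem_openPlaces.1 hp
  have hrise : risingPlaces m a (insert (p, b) R) = risingPlaces m a R := by
    refine filter_congr fun i hi => forall₂_congr fun v hv => ?_
    have hi := mem_range.1 hi
    have : v ≠ b := by omega
    simp [this]
  have hnew : rookInv m (insert (p, b) R) (p, b) = #{i ∈ openPlaces a R | i < p} := by
    rw [rookInv, if_neg (by simp only; omega)]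
    congr 1
    ext i
    simp only [mem_filter, mem_range, mem_openPlaces, mem_insert, Prod.mk.injEq, not_or]
    constructor
    · rintro ⟨hi, h'⟩
      refine ⟨⟨hi.trans hpa, fun v hv => ?_⟩, hi⟩
      exact (h' v (h _ hv).2.le).2 hv
    · rintro ⟨⟨-, h'⟩, hi⟩
      exact ⟨hi, fun u _ => ⟨fun e => hi.ne e.1, h' u⟩⟩
  have hold : ∀ x ∈ R, rookInv m (insert (p, b) R) x = rookInv m R x := by
    intro x hx
    have hx2 := (h x hx).2
    have e : ∀ i u, u ≤ x.2 → ((i, u) ∉ insert (p, b) R ↔ (i, u) ∉ R) := by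
      intro i u hu
      have : u ≠ b := by omega
      simp [this]
    unfold rookInv
    split_ifs
    · congr 1
      exact filter_congr fun u hu => forall₂_congr fun i _ => e i u (mem_range.1 hu).le
    · congr 1
      exact filter_congr fun i _ => forall₂_congr fun u hu => e i u hu
  rw [rookWeight, rookWeight, hrise, sum_insert (hpR b), sum_congr rfl hold, hnew]
  ring

lemma rookWeight_succ_left (hR : R ∈ rooks a b) :
    rookWeight q t m (a + 1) R = rookWeight q t m a R * placeWeight q t m a := by
  have ha : a ∉ risingPlaces m a R := fun h => by simp [risingPlaces] at h
  have hrise : risingPlaces m (a + 1) R = insert a (risingPlaces m a R) := by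
    rw [risingPlaces, range_add_one, filter_insert, if_pos, risingPlaces]
    exact fun v _ hv => lt_irrefl _ ((mem_rooks.1 hR).1 _ hv).1
  rw [rookWeight, rookWeight, hrise, prod_insert ha]
  ring

/-- The choice of `b` makes every available value non-rising at the place `a`. Older rooks look only
at places up to their own. -/
lemma rookWeight_insert_left (hR : R ∈ rooks a b) (hb : b = max (a + 1) m) {v : ℕ}
    (hv : v ∈ openValues b R) :
    rookWeight q t m (a + 1) (insert (a, v) R) =
      rookWeight q t m a R * q ^ #{u ∈ openValues b R | u < v} := by
  obtain ⟨h, h1, h2⟩ := mem_rooks.1 hR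
  obtain ⟨hvb, hvR⟩ := mem_openValues.1 hv
  have hrise : risingPlaces m (a + 1) (insert (a, v) R) = risingPlaces m a R := by
    rw [risingPlaces, range_add_one, filter_insert, if_neg, risingPlaces]
    · refine filter_congr fun i hi => forall₂_congr fun u _ => ?_
      have : i ≠ a := (mem_range.1 hi).ne
      simp [this]
    · exact fun h' => h' v (hb ▸ hvb) (mem_insert_self _ _)
  have hnew : rookInv m (insert (a, v) R) (a, v) = #{u ∈ openValues b R | u < v} := by
    rw [rookInv, if_pos (hb ▸ hvb)]
    congr 1
    ext u
    simp only [mem_filter, mem_range, mem_openValues, mem_insert, Prod.mk.injEq, not_or]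
    constructor
    · rintro ⟨hu, h'⟩
      exact ⟨⟨hu.trans hvb, fun p hp => (h' p (h _ hp).1.le).2 hp⟩, hu⟩
    · rintro ⟨⟨-, h'⟩, hu⟩
      exact ⟨hu, fun p _ => ⟨fun e => hu.ne e.2, h' p⟩⟩
  have hold : ∀ x ∈ R, rookInv m (insert (a, v) R) x = rookInv m R x := by
    intro x hx
    have hx1 := (h x hx).1
    have e : ∀ i u, i ≤ x.1 → ((i, u) ∉ insert (a, v) R ↔ (i, u) ∉ R) := by
      intro i u hu
      have : i ≠ a := by omega
      simp [this]
    unfold rookInv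
    split_ifs
    · congr 1
      exact filter_congr fun u _ => forall₂_congr fun i hi => e i u hi
    · congr 1
      exact filter_congr fun i hi => forall₂_congr fun u _ => e i u (mem_range.1 hi).le
  rw [rookWeight, rookWeight, hrise, sum_insert (hvR a), sum_congr rfl hold, hnew]
  ring

lemma heightSum_succ_right (hab : a ≤ b) (hmb : m ≤ b) (h : ℕ) :
    heightSum q t m a (b + 1) h =
      heightSum q t m a b h + qInt q (h + 1) * heightSum q t m a b (h + 1) := by
  simp only [heightSum, sum_filter]
  rw [sum_rooks_succ_right, sum_add_distrib, mul_sum]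
  congr 1
  refine sum_congr rfl fun R hR => ?_
  have hcard : ∀ p ∈ openPlaces a R, #(insert (p, b) R) = #R + 1 := fun p hp =>
    card_insert_of_notMem ((mem_openPlaces.1 hp).2 b)
  by_cases hh : #R + (h + 1) = a
  · have hopen := card_openPlaces hR
    have : #(openPlaces a R) = h + 1 := by omega
    rw [if_pos hh, ← this, ← sum_pow_card_filter_lt q (openPlaces a R), sum_mul]
    refine sum_congr rfl fun p hp => ?_
    rw [if_pos (by rw [hcard p hp]; omega), rookWeight_insert_right q t hR hab hmb hp, mul_comm]
  · rw [if_neg hh, mul_zero]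
    refine sum_eq_zero fun p hp => if_neg ?_
    rw [hcard p hp]
    omega

/-- The new place stays open, paying its weight, or takes one of the `b - a + (h + 1)` open values.
-/
lemma heightSum_succ_left_succ (hb : b = max (a + 1) m) (h : ℕ) :
    heightSum q t m (a + 1) b (h + 1) =
      placeWeight q t m a * heightSum q t m a b h +
        qInt q (b - a + (h + 1)) * heightSum q t m a b (h + 1) := by
  simp only [heightSum, sum_filter]
  rw [sum_rooks_succ_left, sum_add_distrib, mul_sum, mul_sum]
  congr 1
  · refine sum_congr rfl fun R hR => ?_
    simp only [← add_assoc, add_left_inj, rookWeight_succ_left q t hR]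
    split_ifs
    · ring
    · ring
  refine sum_congr rfl fun R hR => ?_
  have hcard : ∀ v ∈ openValues b R, #(insert (a, v) R) = #R + 1 := fun v hv =>
    card_insert_of_notMem ((mem_openValues.1 hv).2 a)
  by_cases hh : #R + (h + 1) = a
  · have hopen := card_openValues hR
    have : #(openValues b R) = b - a + (h + 1) := by omega
    rw [if_pos hh, ← this, ← sum_pow_card_filter_lt q (openValues b R), sum_mul]
    refine sum_congr rfl fun v hv => ?_
    rw [if_pos (by rw [hcard v hv]; omega), rookWeight_insert_left q t hR hb hv, mul_comm]
  · rw [if_neg hh, mul_zero]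
    refine sum_eq_zero fun v hv => if_neg ?_
    rw [hcard v hv]
    omega

lemma heightSum_succ_left_zero (hb : b = max (a + 1) m) :
    heightSum q t m (a + 1) b 0 = qInt q (b - a) * heightSum q t m a b 0 := by
  simp only [heightSum, sum_filter]
  rw [sum_rooks_succ_left, sum_add_distrib, mul_sum]
  have h0 : ∑ R ∈ rooks a b, (if #R + 0 = a + 1 then rookWeight q t m (a + 1) R else 0) = 0 := by
    refine sum_eq_zero fun R hR => if_neg ?_
    have := card_openPlaces hR
    omega
  rw [h0, zero_add]
  refine sum_congr rfl fun R hR => ?_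
  have hcard : ∀ v ∈ openValues b R, #(insert (a, v) R) = #R + 1 := fun v hv =>
    card_insert_of_notMem ((mem_openValues.1 hv).2 a)
  by_cases hh : #R + 0 = a
  · have hopen := card_openValues hR
    have : #(openValues b R) = b - a := by omega
    rw [if_pos hh, ← this, ← sum_pow_card_filter_lt q (openValues b R), sum_mul]
    refine sum_congr rfl fun v hv => ?_
    rw [if_pos (by rw [hcard v hv]; omega), rookWeight_insert_left q t hR hb hv, mul_comm]
  · rw [if_neg hh, mul_zero]
    refine sum_eq_zero fun v hv => if_neg ?_
    rw [hcard v hv]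
    omega

lemma heightSum_zero_left (h : ℕ) : heightSum q t m 0 b h = if h = 0 then 1 else 0 := by
  simp [heightSum, sum_filter, rooks_zero_left, rookWeight, risingPlaces]

end Weight

/-! ### Normalisation by `q`-factorials and the initial board. -/

section Factorial

variable {K : Type*} [CommRing K] {q t : K} {m : ℕ}

/-- The `q`-factorial. -/
def qFactorial (q : K) (h : ℕ) : K := ∏ i ∈ range h, qInt q (i + 1)

lemma qFactorial_succ (h : ℕ) : qFactorial q (h + 1) = qFactorial q h * qInt q (h + 1) :=
  prod_range_succ _ _

lemma heightSum_const {a : ℕ} (ha : a ≤ m) (t t' : K) : ∀ h,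
    heightSum q t m a m h = heightSum q t' m a m h := by
  induction a with
  | zero => simp [heightSum_zero_left]
  | succ a ih =>
    have hb : m = max (a + 1) m := (max_eq_right ha).symm
    intro h
    cases h with
    | zero => rw [heightSum_succ_left_zero q t hb, heightSum_succ_left_zero q t' hb, ih (by omega)]
    | succ h =>
      rw [heightSum_succ_left_succ q t hb, heightSum_succ_left_succ q t' hb, ih (by omega),
        ih (by omega), placeWeight, placeWeight, if_neg (by omega), if_neg (by omega)]

/-- At `a = m` this is the initial condition of the height recursion. The exponents vary with `a` so
that both sides vanish at `a = 0` and adding a place preserves the relation. -/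
lemma heightSum_ratio {a : ℕ} (ha : a ≤ m) (t : K) : ∀ h,
    (1 - q ^ (m - a + h + 1)) * (qFactorial q (h + 1) * heightSum q t m a m (h + 1)) =
      (q ^ (h + 1) - q ^ (a + 1)) * (qFactorial q h * heightSum q t m a m h) := by
  induction a with
  | zero =>
    intro h
    rcases h with _ | h <;> simp [heightSum_zero_left]
  | succ a ih =>
    obtain ⟨d, rfl⟩ := Nat.exists_eq_add_of_le ha
    have hb : a + 1 + d = max (a + 1) (a + 1 + d) := by omega
    have ih := ih (by omega)
    have e1 : a + 1 + d - a = d + 1 := by omega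
    have e2 : a + 1 + d - (a + 1) = d := by omega
    simp only [e1, e2] at ih ⊢
    have hw : placeWeight q t (a + 1 + d) a = q ^ (a + 1) := by
      rw [placeWeight, if_neg (by omega), one_mul]
    -- The hypothesis for `a` lets the two terms of the recursion merge into a multiple of the
    -- single entry at height `h`.
    have upper : ∀ h, (1 - q ^ (d + h + 1)) *
        (qFactorial q (h + 1) * heightSum q t (a + 1 + d) (a + 1) (a + 1 + d) (h + 1)) =
        qInt q (d + h + 1) * (q ^ (h + 1) - q ^ (a + h + 2)) *
          (qFactorial q h * heightSum q t (a + 1 + d) a (a + 1 + d) h) := by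
      intro h
      have i0 := ih h
      have s1 := one_sub_mul_qInt q (d + h + 1)
      have s2 := one_sub_mul_qInt q (h + 1)
      have s3 := one_sub_mul_qInt q (d + 1 + h + 1)
      rw [heightSum_succ_left_succ q t hb, hw, e1, ← add_assoc (d + 1)]
      rw [← s3, qFactorial_succ] at i0
      rw [← s1, qFactorial_succ]
      generalize qInt q (d + h + 1) = D at *
      generalize qInt q (d + 1 + h + 1) = D' at *
      generalize qInt q (h + 1) = J at *
      linear_combination D * i0 +
        D * q ^ (a + 1) * (qFactorial q h * heightSum q t (a + 1 + d) a (a + 1 + d) h) * s2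
    intro h
    rw [upper h]
    cases h with
    | zero =>
      rw [heightSum_succ_left_zero q t hb, e1]
      ring
    | succ h =>
      have i0 := ih h
      have s2 := one_sub_mul_qInt q (h + 1)
      have s3 := one_sub_mul_qInt q (d + 1 + h + 1)
      rw [heightSum_succ_left_succ q t hb, hw, e1, ← add_assoc (d + 1),
        show d + (h + 1) + 1 = d + 1 + h + 1 by ring]
      rw [← s3, qFactorial_succ] at i0
      rw [qFactorial_succ]
      generalize qInt q (d + 1 + h + 1) = D' at *
      generalize qInt q (h + 1) = J at *
      linear_combination q ^ (a + 2) * J * i0 - q ^ (a + 2) * D' * (qFactorial q h * J *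
        heightSum q t (a + 1 + d) a (a + 1 + d) (h + 1)) * s2

/-- The recursion of the total weights of the full rook placements. -/
theorem heightSum_zero_recursion [IsDomain K] (hq : q ≠ 1) (n : ℕ) (hn : m ≤ n) (t : K) :
    (1 - q) * heightSum q t m (n + 1) (n + 1) 0 =
      (1 - t * q ^ (n + 1)) * heightSum q t m n n 0 -
        (1 - t) * q ^ (m + 1) * heightSum q (t * q) m n n 0 := by
  -- The factor `[h]_q!` absorbs the `[h + 1]_q` from choosing an open place, so adding a value
  -- becomes `F_h + F_{h+1}`; it is `1` at `h = 0`.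
  have main := height_zero_recursion (q := q) (m := m)
    (F := fun n t h => qFactorial q h * heightSum q t m n n h) hq ?_ ?_ ?_ ?_ n hn t
  · simpa [qFactorial] using main
  · intro t t' h
    rw [heightSum_const le_rfl t t']
  · intro t h
    simpa using heightSum_ratio (q := q) (le_refl m) t h
  · intro n hn t
    have hb : n + 1 = max (n + 1) m := by omega
    simp only [heightSum_succ_left_zero q t hb, heightSum_succ_right q t le_rfl hn,
      qFactorial_succ, Nat.add_sub_cancel_left, zero_add, qInt_one]
    ring
  · intro n hn t h
    have hb : n + 1 = max (n + 1) m := by omega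
    have hw : placeWeight q t m n = t * q ^ (n + 1) := by rw [placeWeight, if_pos hn]
    simp only [heightSum_succ_left_succ q t hb, heightSum_succ_right q t le_rfl hn, hw,
      qFactorial_succ, Nat.add_sub_cancel_left, show 1 + (h + 1) = h + 2 by omega]
    ring

end Factorial

/-! ### Full placements as permutations, with weight `t^exc_r q^den_r`. -/

/-- The full rook placement of a permutation. -/
def permRooks {n : ℕ} (π : Equiv.Perm (Fin n)) : Finset (ℕ × ℕ) :=
  univ.image fun i : Fin n => ((i : ℕ), (π i : ℕ))

section PermRooks

variable {n : ℕ} (π : Equiv.Perm (Fin n))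

lemma mem_permRooks {p v : ℕ} :
    (p, v) ∈ permRooks π ↔ ∃ i : Fin n, (i : ℕ) = p ∧ (π i : ℕ) = v := by
  simp [permRooks]

lemma permRooks_inner_injective (π : Equiv.Perm (Fin n)) :
    Function.Injective fun i : Fin n => ((i : ℕ), (π i : ℕ)) :=
  fun _ _ h => Fin.ext (congrArg Prod.fst h)

lemma permRooks_mem_rooks : permRooks π ∈ rooks n n ∧ #(permRooks π) = n := by
  refine ⟨?_, ?_⟩
  · rw [mem_rooks]
    simp only [permRooks, mem_image, mem_univ, true_and]
    refine ⟨?_, ?_, ?_⟩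
    · rintro _ ⟨i, rfl⟩
      exact ⟨i.2, (π i).2⟩
    · rintro _ ⟨i, rfl⟩ _ ⟨j, rfl⟩ h
      rw [Fin.ext h]
    · rintro _ ⟨i, rfl⟩ _ ⟨j, rfl⟩ h
      rw [π.injective (Fin.ext h)]
  · rw [permRooks, card_image_of_injective _ (permRooks_inner_injective π), card_univ,
      Fintype.card_fin]

lemma permRooks_injective : Function.Injective (permRooks (n := n)) := by
  intro π σ h
  ext i
  have : ((i : ℕ), (π i : ℕ)) ∈ permRooks σ := h ▸ (mem_permRooks π).2 ⟨i, rfl, rfl⟩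
  obtain ⟨j, hj, hv⟩ := (mem_permRooks σ).1 this
  rw [← hv, Fin.ext hj]

lemma exists_permRooks_eq {R : Finset (ℕ × ℕ)} (hR : R ∈ rooks n n) (hcard : #R = n) :
    ∃ π : Equiv.Perm (Fin n), permRooks π = R := by
  obtain ⟨h, h1, h2⟩ := mem_rooks.1 hR
  have hopen : openPlaces n R = ∅ := by
    have := card_openPlaces hR
    exact card_eq_zero.1 (by omega)
  have hex : ∀ i : Fin n, ∃ v : Fin n, ((i : ℕ), (v : ℕ)) ∈ R := by
    intro i
    by_contra! hi
    have : (i : ℕ) ∈ openPlaces n R :=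
      mem_openPlaces.2 ⟨i.2, fun v hv => hi ⟨v, (h _ hv).2⟩ hv⟩
    simp [hopen] at this
  choose f hf using hex
  have hinj : Function.Injective f := by
    intro i j hij
    have := h2 _ (hf i) _ (hf j) (congrArg Fin.val hij)
    exact Fin.ext (congrArg Prod.fst this)
  refine ⟨Equiv.ofBijective f (Finite.injective_iff_bijective.1 hinj), ?_⟩
  refine eq_of_subset_of_card_le ?_ ?_
  · intro x hx
    obtain ⟨i, -, rfl⟩ := mem_image.1 hx
    exact hf i
  · rw [(permRooks_mem_rooks _).2, hcard]

lemma sum_rooks_full {M : Type*} [AddCommMonoid M] (f : Finset (ℕ × ℕ) → M) :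
    ∑ R ∈ rooks n n with #R + 0 = n, f R = ∑ π : Equiv.Perm (Fin n), f (permRooks π) := by
  symm
  refine sum_bij (fun π _ => permRooks π) ?_ ?_ ?_ ?_
  · exact fun π _ => mem_filter.2 (permRooks_mem_rooks π)
  · exact fun π _ σ _ h => permRooks_injective h
  · intro R hR
    obtain ⟨hR, hcard⟩ := mem_filter.1 hR
    obtain ⟨π, hπ⟩ := exists_permRooks_eq hR hcard
    exact ⟨π, mem_univ _, hπ⟩
  · intros
    rfl

variable {m : ℕ}

lemma mem_rExcp_succ {i : Fin n} : i ∈ rExcp (m + 1) π ↔ max ((i : ℕ) + 1) m ≤ π i := by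
  rw [rExcp, mem_filter]
  simp only [letter, place, mem_univ, true_and]
  omega

lemma risingPlaces_permRooks :
    risingPlaces m n (permRooks π) = (rExcp (m + 1) π).map Fin.valEmbedding := by
  ext p
  simp only [risingPlaces, mem_filter, mem_range, mem_map, Fin.valEmbedding_apply]
  constructor
  · rintro ⟨hp, h⟩
    refine ⟨⟨p, hp⟩, (mem_rExcp_succ π).2 ?_, rfl⟩
    by_contra! hlt
    exact h _ hlt ((mem_permRooks π).2 ⟨⟨p, hp⟩, rfl, rfl⟩)
  · rintro ⟨i, hi, rfl⟩
    refine ⟨i.2, fun v hv hmem => ?_⟩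
    obtain ⟨j, hj, rfl⟩ := (mem_permRooks π).1 hmem
    rw [Fin.ext hj] at hv
    exact absurd ((mem_rExcp_succ π).1 hi) (not_le.2 hv)

lemma rookInv_permRooks_of_mem {i : Fin n} (hi : i ∈ rExcp (m + 1) π) :
    rookInv m (permRooks π) (i, π i) = #{j | j < i ∧ π i < π j} := by
  rw [rookInv, if_neg (not_lt.2 ((mem_rExcp_succ π).1 hi))]
  symm
  refine card_bij (fun j _ => (j : ℕ)) ?_ (fun _ _ _ _ h => Fin.ext h) ?_
  · intro j hj
    simp only [mem_filter, mem_univ, true_and, mem_range] at hj ⊢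
    refine ⟨hj.1, fun u hu hmem => ?_⟩
    obtain ⟨k, hk, rfl⟩ := (mem_permRooks π).1 hmem
    rw [Fin.ext hk] at hu
    exact absurd hj.2 (not_lt.2 hu)
  · intro p hp
    simp only [mem_filter, mem_range] at hp
    refine ⟨⟨p, hp.1.trans i.2⟩, ?_, rfl⟩
    simp only [mem_filter, mem_univ, true_and]
    refine ⟨hp.1, ?_⟩
    by_contra! hle
    exact hp.2 _ hle ((mem_permRooks π).2 ⟨_, rfl, rfl⟩)

lemma rookInv_permRooks_of_notMem {i : Fin n} (hi : i ∉ rExcp (m + 1) π) :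
    rookInv m (permRooks π) (i, π i) = #{j | i < j ∧ π j < π i} := by
  rw [rookInv, if_pos (not_le.1 fun h => hi ((mem_rExcp_succ π).2 h))]
  symm
  refine card_bij (fun j _ => (π j : ℕ)) ?_ (fun _ _ _ _ h => π.injective (Fin.ext h)) ?_
  · intro j hj
    simp only [mem_filter, mem_univ, true_and, mem_range] at hj ⊢
    refine ⟨hj.2, fun p hp hmem => ?_⟩
    obtain ⟨k, rfl, hk⟩ := (mem_permRooks π).1 hmem
    rw [π.injective (Fin.ext hk)] at hp
    exact absurd hj.1 (not_lt.2 hp)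
  · intro u hu
    simp only [mem_filter, mem_range] at hu
    refine ⟨π.symm ⟨u, hu.1.trans (π i).2⟩, ?_, by simp⟩
    simp only [mem_filter, mem_univ, true_and, Equiv.apply_symm_apply]
    refine ⟨?_, hu.1⟩
    by_contra! hle
    exact hu.2 _ hle ((mem_permRooks π).2 ⟨_, rfl, by simp⟩)

lemma card_filter_prod_eq_sum {α β : Type*} [Fintype α] [Fintype β] (Q : α × β → Prop)
    [DecidablePred Q] : #{p | Q p} = ∑ i, #{j | Q (i, j)} := by
  simp only [card_filter, Fintype.sum_prod_type]

lemma card_filter_prod_eq_sum' {α β : Type*} [Fintype α] [Fintype β] (Q : α × β → Prop)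
    [DecidablePred Q] : #{p | Q p} = ∑ j, #{i | Q (i, j)} := by
  simp only [card_filter, Fintype.sum_prod_type_right]

/-- A larger letter to the left of a rising letter is rising, and a smaller letter to the right of a
non-rising one is non-rising. So each inversion inside a class is counted once: at its right end for
rising letters, at its left end for the others. -/
lemma sum_rookInv_permRooks :
    ∑ x ∈ permRooks π, rookInv m (permRooks π) x =
      invAt π (rExcp (m + 1) π) + invAt π (rExcp (m + 1) π)ᶜ := by
  have e1 : invAt π (rExcp (m + 1) π) =
      ∑ i, if i ∈ rExcp (m + 1) π then rookInv m (permRooks π) (i, π i) else 0 := by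
    rw [invAt, Inv, filter_filter, card_filter_prod_eq_sum']
    refine sum_congr rfl fun i _ => ?_
    split_ifs with hi
    · rw [rookInv_permRooks_of_mem π hi]
      congr 1
      ext j
      simp only [mem_rExcp_succ, letter, mem_filter, mem_univ, true_and] at hi ⊢
      simp only [Fin.lt_def]
      omega
    · simp [hi]
  have e2 : invAt π (rExcp (m + 1) π)ᶜ =
      ∑ i, if i ∈ rExcp (m + 1) π then 0 else rookInv m (permRooks π) (i, π i) := by
    rw [invAt, Inv, filter_filter, card_filter_prod_eq_sum]
    refine sum_congr rfl fun i _ => ?_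
    split_ifs with hi
    · simp [hi]
    · rw [rookInv_permRooks_of_notMem π hi]
      congr 1
      ext j
      simp only [mem_rExcp_succ, mem_compl, letter, mem_filter, mem_univ, true_and] at hi ⊢
      simp only [Fin.lt_def]
      omega
  rw [e1, e2, ← sum_add_distrib]
  nth_rw 1 [permRooks]
  rw [sum_image fun i _ j _ h => permRooks_inner_injective π h]
  refine sum_congr rfl fun i _ => ?_
  split_ifs <;> simp

variable {K : Type*} [CommRing K] (q t : K)

lemma rookWeight_permRooks :
    rookWeight q t m n (permRooks π) =
      t ^ excLevel (m + 1) n π * q ^ denLevel (m + 1) n π := by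
  have e : excLevel (m + 1) n π = #((rExcp (m + 1) π).filter fun i : Fin n => m ≤ (i : ℕ)) := by
    rw [excLevel, rExcp, filter_filter]
    congr 1
    refine filter_congr fun i _ => ?_
    simp only [letter, place]
    omega
  simp only [rookWeight, risingPlaces_permRooks]
  rw [sum_rookInv_permRooks, denLevel, e, prod_map, add_assoc,
    pow_add q (∑ i ∈ rExcp (m + 1) π, place i), ← mul_assoc]
  congr 1
  simp only [placeWeight, Fin.valEmbedding_apply, prod_mul_distrib, prod_ite, prod_const_one,
    mul_one, prod_const, place, prod_pow_eq_pow_sum]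

lemma heightSum_eq_sum_perm :
    heightSum q t m n n 0 = ∑ π : Equiv.Perm (Fin n),
      t ^ excLevel (m + 1) n π * q ^ denLevel (m + 1) n π := by
  rw [heightSum, sum_rooks_full]
  exact sum_congr rfl fun π _ => rookWeight_permRooks π q t

end PermRooks

/-! ### Insertion of the largest letter and the pair `(rdes, rmaj)`. -/

section InsertMax

variable {n : ℕ}

/-- Insert the largest letter into the one-line notation of `σ` at the position `j`. -/
def insertMax (j : Fin (n + 1)) (σ : Equiv.Perm (Fin n)) : Equiv.Perm (Fin (n + 1)) :=
  (finSuccEquiv' j).trans ((Equiv.optionCongr σ).trans (finSuccEquiv' (Fin.last n)).symm)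

variable (j : Fin (n + 1)) (σ : Equiv.Perm (Fin n))

@[simp] lemma insertMax_self : insertMax j σ j = Fin.last n := by
  simp [insertMax]

@[simp] lemma insertMax_succAbove (i : Fin n) :
    insertMax j σ (j.succAbove i) = (σ i).castSucc := by
  simp [insertMax]

lemma insertMax_bijective : Function.Bijective
    fun x : Fin (n + 1) × Equiv.Perm (Fin n) => insertMax x.1 x.2 := by
  rw [Fintype.bijective_iff_injective_and_card]
  constructor
  · rintro ⟨j, σ⟩ ⟨j', σ'⟩ h
    simp only at h
    have hj : j = j' := by
      have h1 : insertMax j' σ' j = Fin.last n := by rw [← h, insertMax_self]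
      rw [← insertMax_self j' σ'] at h1
      exact (insertMax j' σ').injective h1
    subst hj
    have hσ : σ = σ' := by
      ext i
      have h1 := insertMax_succAbove j σ i
      rw [h, insertMax_succAbove] at h1
      rw [Fin.castSucc_injective _ h1]
    rw [hσ]
  · simp [Fintype.card_perm, Nat.factorial_succ]

lemma val_succAbove (i : Fin n) :
    (j.succAbove i : ℕ) = if (i : ℕ) < j then (i : ℕ) else i + 1 := by
  simp only [Fin.succAbove, Fin.lt_def]
  split_ifs <;> simp_all

lemma mem_rDes {r : ℕ} {π : Equiv.Perm (Fin n)} {i : Fin n} :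
    i ∈ rDes r π ↔ ∃ k : Fin n, (k : ℕ) = i + 1 ∧ (π k : ℕ) + r ≤ π i := by
  rw [rDes, mem_filter]
  simp only [place, letter, mem_univ, true_and]
  exact exists_congr fun k => by omega

variable (r : ℕ)

lemma self_mem_rDes_insertMax :
    j ∈ rDes r (insertMax j σ) ↔ ∃ i : Fin n, i.castSucc = j ∧ (σ i : ℕ) + r ≤ n := by
  rw [mem_rDes, insertMax_self, Fin.val_last]
  constructor
  · rintro ⟨k, hk, h⟩
    rcases Fin.eq_self_or_eq_succAbove j k with rfl | ⟨i, rfl⟩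
    · omega
    · rw [insertMax_succAbove, Fin.val_castSucc] at h
      refine ⟨i, Fin.ext ?_, h⟩
      rw [val_succAbove] at hk
      rw [Fin.val_castSucc]
      split_ifs at hk <;> omega
  · rintro ⟨i, rfl, h⟩
    refine ⟨i.castSucc.succAbove i, ?_, ?_⟩
    · simp
    · rwa [insertMax_succAbove]

lemma succAbove_mem_rDes_insertMax (i : Fin n) :
    j.succAbove i ∈ rDes r (insertMax j σ) ↔ i ∈ rDes r σ ∧ i.succ ≠ j := by
  simp only [mem_rDes, insertMax_succAbove, Fin.val_castSucc, Ne, Fin.ext_iff, Fin.val_succ]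
  constructor
  · rintro ⟨k, hk, h⟩
    rcases Fin.eq_self_or_eq_succAbove j k with rfl | ⟨k, rfl⟩
    · rw [insertMax_self, Fin.val_last] at h
      have := (σ i).2
      omega
    · rw [insertMax_succAbove, Fin.val_castSucc] at h
      simp only [val_succAbove] at hk
      refine ⟨⟨k, ?_, h⟩, ?_⟩ <;> split_ifs at hk <;> omega
  · rintro ⟨⟨k, hk, h⟩, hj⟩
    refine ⟨j.succAbove k, ?_, by simpa using h⟩
    simp only [val_succAbove]
    split_ifs <;> omega

lemma sum_rDes_insertMax (f : Fin (n + 1) → ℕ) :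
    ∑ x ∈ rDes r (insertMax j σ), f x =
      (if j ∈ rDes r (insertMax j σ) then f j else 0) +
        ∑ i ∈ rDes r σ with i.succ ≠ j, f (j.succAbove i) := by
  rw [← univ_inter (rDes r (insertMax j σ)), ← sum_ite_mem, Fin.sum_univ_succAbove _ j]
  simp only [succAbove_mem_rDes_insertMax, univ_inter]
  rw [← sum_filter]
  congr 2
  ext i
  simp

/-- The letters of `σ` that a new largest letter does not exceed by `r`. -/
def bigPlaces (σ : Equiv.Perm (Fin n)) : Finset (Fin n) := {i | n < σ i + r}

lemma mem_bigPlaces {i : Fin n} : i ∈ bigPlaces r σ ↔ n < σ i + r := by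
  simp [bigPlaces]

lemma card_rInv_insertMax :
    #(rInv r (insertMax j σ)) = #(rInv r σ) + #{i ∈ bigPlaces r σ | j ≤ i.castSucc} := by
  have key : ∀ {k : ℕ} (π : Equiv.Perm (Fin k)), #(rInv r π) =
      ∑ x, ∑ y, if x < y ∧ π y < π x ∧ (π x : ℕ) < π y + r then 1 else 0 := by
    intro k π
    rw [rInv, Inv, filter_filter, card_filter_prod_eq_sum]
    refine sum_congr rfl fun x _ => ?_
    rw [card_filter]
    refine sum_congr rfl fun y _ => ?_
    congr 1
    simp only [letter, Fin.lt_def, eq_iff_iff]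
    omega
  rw [key, key, Fin.sum_univ_succAbove _ j, Fin.sum_univ_succAbove _ j]
  simp only [Fin.sum_univ_succAbove _ j, insertMax_self, insertMax_succAbove, lt_irrefl, false_and,
    Fin.val_last, Fin.val_castSucc, Fin.succAbove_lt_succAbove_iff, Fin.castSucc_lt_castSucc_iff,
    Fin.lt_succAbove_iff_le_castSucc, Fin.castSucc_lt_last, not_lt.2 (Fin.le_last _), and_false,
    if_false, zero_add, true_and]
  rw [add_comm, ← card_filter]
  congr 2
  ext i
  simp [mem_bigPlaces, and_comm]

/-- The positions where the insertion of a largest letter creates no new `r`-descent. -/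
def stablePositions : Finset (Fin (n + 1)) :=
  insert (Fin.last n) ((rDes r σ).image Fin.succ ∪ (bigPlaces r σ).image Fin.castSucc)

lemma card_filter_stablePositions (p : Fin (n + 1) → Prop) [DecidablePred p] :
    #{x ∈ stablePositions σ r | p x} = (if p (Fin.last n) then 1 else 0) +
      #{i ∈ rDes r σ | p i.succ} + #{i ∈ bigPlaces r σ | p i.castSucc} := by
  -- The letter after an `r`-descent is at least `r` below another letter of `σ`, hence not big.
  have hdisj : Disjoint ((rDes r σ).image Fin.succ) ((bigPlaces r σ).image Fin.castSucc) := by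
    rw [disjoint_left]
    intro x hx hx'
    obtain ⟨i, hi, rfl⟩ := mem_image.1 hx
    obtain ⟨k, hk, he⟩ := mem_image.1 hx'
    obtain ⟨k', hk', h⟩ := mem_rDes.1 hi
    rw [mem_bigPlaces] at hk
    have hkk : k = k' := by
      rw [Fin.ext_iff] at he ⊢
      rw [Fin.val_castSucc, Fin.val_succ] at he
      omega
    subst hkk
    have := (σ i).2
    omega
  have hlast : Fin.last n ∉
      (rDes r σ).image Fin.succ ∪ (bigPlaces r σ).image Fin.castSucc := by
    intro h
    rcases mem_union.1 h with h | h <;> obtain ⟨i, hi, he⟩ := mem_image.1 h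
    · obtain ⟨k, hk, -⟩ := mem_rDes.1 hi
      rw [Fin.ext_iff, Fin.val_succ, Fin.val_last] at he
      have := k.2
      omega
    · exact (Fin.castSucc_lt_last i).ne he
  rw [stablePositions, card_filter, sum_insert hlast, sum_union hdisj,
    sum_image (Fin.succ_injective n).injOn, sum_image (Fin.castSucc_injective n).injOn,
    ← card_filter, ← card_filter, add_assoc]

lemma ite_mem_stablePositions : (if j ∈ stablePositions σ r then 1 else 0) =
    (if j = Fin.last n then 1 else 0) + #{i ∈ rDes r σ | i.succ = j} +
      #{i ∈ bigPlaces r σ | i.castSucc = j} := by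
  have h := card_filter_stablePositions σ r (· = j)
  rw [filter_eq', apply_ite card, card_singleton, card_empty] at h
  rw [h]
  simp only [eq_comm]

/-- The new letter is last, or precedes a big letter, or starts an `r`-descent, and these exclude
each other. -/
lemma ite_self_mem_rDes_insertMax : (if j ∈ rDes r (insertMax j σ) then 1 else 0) +
    (if j = Fin.last n then 1 else 0) + #{i ∈ bigPlaces r σ | i.castSucc = j} = 1 := by
  rcases Fin.eq_castSucc_or_eq_last j with ⟨i, rfl⟩ | rfl
  · have h : #{k ∈ bigPlaces r σ | k.castSucc = i.castSucc} =
        if i ∈ bigPlaces r σ then 1 else 0 := by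
      simp only [Fin.castSucc_inj]
      rw [filter_eq', apply_ite card, card_singleton, card_empty]
    rw [h, if_neg (Fin.castSucc_lt_last i).ne]
    simp only [self_mem_rDes_insertMax, Fin.castSucc_inj, exists_eq_left, mem_bigPlaces]
    split_ifs <;> omega
  · have h : #{k ∈ bigPlaces r σ | k.castSucc = Fin.last n} = 0 := by
      rw [card_eq_zero, filter_eq_empty_iff]
      exact fun k _ => (Fin.castSucc_lt_last k).ne
    rw [h, if_pos rfl, if_neg]
    rw [self_mem_rDes_insertMax]
    rintro ⟨i, hi, -⟩
    exact (Fin.castSucc_lt_last i).ne hi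

lemma rdes_insertMax : rdes r (n + 1) (insertMax j σ) =
    rdes r n σ + if j ∈ stablePositions σ r then 0 else 1 := by
  have h1 := ite_mem_stablePositions j σ r
  have h2 := ite_self_mem_rDes_insertMax j σ r
  have h3 := sum_rDes_insertMax j σ r fun _ => 1
  have h4 := card_filter_add_card_filter_not (s := rDes r σ) fun i => i.succ = j
  rw [← card_eq_sum_ones, ← card_eq_sum_ones] at h3
  rw [rdes, rdes]
  simp only [Ne] at h3
  split_ifs at * <;> omega

/-- Each `r`-descent to the right moves by one place, and each big letter to the right gives a new
pair of `rInv`; together with the last position these are the stable positions after `j`. A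
non-stable `j` also adds its own descent place. -/
lemma rmaj_insertMax : rmaj r (n + 1) (insertMax j σ) = rmaj r n σ +
    if j ∈ stablePositions σ r then #{x ∈ stablePositions σ r | j < x}
    else #(stablePositions σ r) + #{x ∈ (stablePositions σ r)ᶜ | x < j} := by
  have h1 := ite_mem_stablePositions j σ r
  have h2 := ite_self_mem_rDes_insertMax j σ r
  have h3 := sum_rDes_insertMax j σ r place
  have h4 : ∑ i ∈ rDes r σ with i.succ = j, place i + ∑ i ∈ rDes r σ with i.succ ≠ j, place i =
      ∑ i ∈ rDes r σ, place i :=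
    sum_filter_add_sum_filter_not (rDes r σ) (fun i => i.succ = j) place
  have h5 := card_rInv_insertMax j σ r
  have h6 := card_filter_stablePositions σ r (j < ·)
  have h7 : ∑ i ∈ rDes r σ with i.succ = j, place i = #{i ∈ rDes r σ | i.succ = j} * j := by
    rw [← smul_eq_mul]
    refine sum_const_nat fun i hi => ?_
    rw [← (mem_filter.1 hi).2, Fin.val_succ, place]
  have h8 : ∑ i ∈ rDes r σ with i.succ ≠ j, place (j.succAbove i) =
      ∑ i ∈ rDes r σ with i.succ ≠ j, place i + #{i ∈ rDes r σ | j < i.succ} := by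
    have : #{i ∈ rDes r σ | j < i.succ} =
        ∑ i ∈ rDes r σ with i.succ ≠ j, if j < i.succ then 1 else 0 := by
      rw [← card_filter, filter_filter]
      congr 1
      exact filter_congr fun i _ => ⟨fun h => ⟨h.ne', h⟩, fun h => h.2⟩
    rw [this, ← sum_add_distrib]
    refine sum_congr rfl fun i hi => ?_
    have := (mem_filter.1 hi).2
    simp only [place, val_succAbove, Fin.lt_def, Fin.val_succ, Ne, Fin.ext_iff] at this ⊢
    split_ifs <;> omega
  have h9 : #{i ∈ bigPlaces r σ | j ≤ i.castSucc} =
      #{i ∈ bigPlaces r σ | j < i.castSucc} + #{i ∈ bigPlaces r σ | i.castSucc = j} := by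
    rw [← card_filter_add_card_filter_not (s := {i ∈ bigPlaces r σ | j ≤ i.castSucc})
      (fun i => j < i.castSucc), filter_filter, filter_filter]
    congr 2
    · exact filter_congr fun i _ => ⟨fun h => h.2, fun h => ⟨h.le, h⟩⟩
    · exact filter_congr fun i _ => ⟨fun h => le_antisymm (not_lt.1 h.2) h.1,
        fun h => ⟨h.ge, h.not_gt⟩⟩
  have h10 : (if j < Fin.last n then 1 else 0) + (if j = Fin.last n then 1 else 0) = 1 := by
    rcases (Fin.le_last j).lt_or_eq with h | h
    · rw [if_pos h, if_neg h.ne]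
    · rw [if_pos h, if_neg h.not_lt]
  simp only [rmaj, h3, h5, h8, h9]
  by_cases hj : j ∈ stablePositions σ r
  · rw [if_pos hj] at h1 ⊢
    -- Insertion just after an `r`-descent replaces it by one a place further right.
    have h11 : (if j ∈ rDes r (insertMax j σ) then place j else 0) =
        #{i ∈ rDes r σ | i.succ = j} * j + if j ∈ rDes r (insertMax j σ) then 1 else 0 := by
      have : #{i ∈ rDes r σ | i.succ = j} = if j ∈ rDes r (insertMax j σ) then 1 else 0 := by
        omega
      rw [this]
      split_ifs <;> simp [place]
    omega
  · rw [if_neg hj] at h1 ⊢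
    have h11 : #(stablePositions σ r) + #{x ∈ (stablePositions σ r)ᶜ | x < j} =
        j + #{x ∈ stablePositions σ r | j < x} := by
      have e1 := card_filter_add_card_filter_not (s := stablePositions σ r) fun x => x < j
      have e2 : #{x ∈ stablePositions σ r | ¬ x < j} = #{x ∈ stablePositions σ r | j < x} := by
        congr 1
        refine filter_congr fun x hx => ?_
        have : x ≠ j := fun h => hj (h ▸ hx)
        exact ⟨fun h => lt_of_le_of_ne (not_lt.1 h) this.symm, fun h => h.not_gt⟩
      have e3 := card_filter_add_card_filter_not (s := {x : Fin (n + 1) | x < j})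
        fun x => x ∈ stablePositions σ r
      have e4 : #{x : Fin (n + 1) | x < j} = j := by
        rw [← Fin.card_Iio j]
        congr 1
        ext x
        simp
      have e5 : ({x : Fin (n + 1) | x < j} : Finset _).filter (· ∈ stablePositions σ r) =
          {x ∈ stablePositions σ r | x < j} := by
        ext x
        simp [and_comm]
      have e6 : ({x : Fin (n + 1) | x < j} : Finset _).filter (· ∉ stablePositions σ r) =
          {x ∈ (stablePositions σ r)ᶜ | x < j} := by
        ext x
        simp [and_comm]
      rw [e5, e6, e4] at e3
      omega
    have h12 : j ∈ rDes r (insertMax j σ) := by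
      by_contra h
      rw [if_neg h] at h2
      omega
    have h13 : #{i ∈ rDes r σ | i.succ = j} = 0 := by omega
    rw [h13, zero_mul] at h7
    have h14 : (if j ∈ rDes r (insertMax j σ) then place j else 0) = j + 1 := if_pos h12
    omega

lemma card_stablePositions (m : ℕ) (hm : m ≤ n) :
    #(stablePositions σ (m + 1)) = rdes (m + 1) n σ + (m + 1) := by
  have h := card_filter_stablePositions σ (m + 1) fun _ => True
  simp only [filter_true, if_true] at h
  have hbig : #(bigPlaces (m + 1) σ) = m := by
    have e : (bigPlaces (m + 1) σ).image (fun i => (σ i : ℕ)) = Ico (n - m) n := by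
      ext v
      simp only [mem_image, mem_bigPlaces, mem_Ico]
      constructor
      · rintro ⟨i, hi, rfl⟩
        exact ⟨by omega, (σ i).2⟩
      · rintro ⟨h1, h2⟩
        exact ⟨σ.symm ⟨v, h2⟩, by simp only [Equiv.apply_symm_apply]; omega, by simp⟩
    rw [← card_image_of_injective _ fun i k hik => σ.injective (Fin.ext hik), e, Nat.card_Ico]
    omega
  rw [h, hbig, rdes]
  ring

variable {K : Type*} [CommRing K] (q t : K)

/-- With `N` stable positions the factor is `[N]_q + t q^N [n + 1 - N]_q`. As `N = rdes + r`, the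
part `q^rdes` of `q^N` turns `t` into `tq`. -/
lemma sum_insertMax (m : ℕ) (hm : m ≤ n) :
    (1 - q) * ∑ j, t ^ rdes (m + 1) (n + 1) (insertMax j σ) *
        q ^ rmaj (m + 1) (n + 1) (insertMax j σ) =
      (1 - t * q ^ (n + 1)) * (t ^ rdes (m + 1) n σ * q ^ rmaj (m + 1) n σ) -
        (1 - t) * q ^ (m + 1) * ((t * q) ^ rdes (m + 1) n σ * q ^ rmaj (m + 1) n σ) := by
  set N := stablePositions σ (m + 1) with hN
  have hcard : #N = rdes (m + 1) n σ + (m + 1) := card_stablePositions σ m hm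
  have hcompl : #N + #Nᶜ = n + 1 := by simp [card_add_card_compl]
  have e : ∑ j, t ^ rdes (m + 1) (n + 1) (insertMax j σ) *
      q ^ rmaj (m + 1) (n + 1) (insertMax j σ) = t ^ rdes (m + 1) n σ * q ^ rmaj (m + 1) n σ *
        (qInt q #N + t * q ^ #N * qInt q #Nᶜ) := by
    rw [← sum_pow_card_filter_gt q N, ← sum_pow_card_filter_lt q Nᶜ, mul_add, mul_sum, mul_sum,
      mul_sum, ← sum_add_sum_compl N]
    congr 1
    · refine sum_congr rfl fun j hj => ?_
      rw [rdes_insertMax, rmaj_insertMax, if_pos hj, if_pos hj, ← hN]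
      ring
    · refine sum_congr rfl fun j hj => ?_
      rw [rdes_insertMax, rmaj_insertMax, if_neg (mem_compl.1 hj), if_neg (mem_compl.1 hj), ← hN]
      ring
  have s1 := one_sub_mul_qInt q #N
  have s2 := one_sub_mul_qInt q #Nᶜ
  have s3 : q ^ #N * q ^ #Nᶜ = q ^ (n + 1) := by rw [← pow_add, hcompl]
  have s4 : q ^ #N = q ^ rdes (m + 1) n σ * q ^ (m + 1) := by rw [← pow_add, hcard]
  rw [e, mul_pow]
  linear_combination t ^ rdes (m + 1) n σ * q ^ rmaj (m + 1) n σ *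
    (s1 + t * q ^ #N * s2 - t * s3 - (1 - t) * s4)

/-- The recursion of the `r`-Euler-Mahonian polynomials, by insertion of the largest letter. -/
theorem sum_rdes_rmaj_recursion (m : ℕ) (hm : m ≤ n) :
    (1 - q) * ∑ π : Equiv.Perm (Fin (n + 1)),
        t ^ rdes (m + 1) (n + 1) π * q ^ rmaj (m + 1) (n + 1) π =
      (1 - t * q ^ (n + 1)) * (∑ σ : Equiv.Perm (Fin n),
          t ^ rdes (m + 1) n σ * q ^ rmaj (m + 1) n σ) -
        (1 - t) * q ^ (m + 1) * ∑ σ : Equiv.Perm (Fin n),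
          (t * q) ^ rdes (m + 1) n σ * q ^ rmaj (m + 1) n σ := by
  rw [← insertMax_bijective.sum_comp, Fintype.sum_prod_type_right, mul_sum, mul_sum, mul_sum,
    ← sum_sub_distrib]
  exact sum_congr rfl fun σ _ => sum_insertMax σ q t m hm

end InsertMax

/-! ### Sizes below `r`: both pairs reduce to `(0, inv)`. -/

section SmallSize

variable {n r : ℕ} (π : Equiv.Perm (Fin n))

lemma rDes_eq_empty (h : n ≤ r) : rDes r π = ∅ := by
  refine eq_empty_of_forall_notMem fun i hi => ?_
  obtain ⟨k, -, hk⟩ := mem_rDes.1 hi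
  have := (π i).2
  omega

lemma rInv_eq_Inv (h : n ≤ r) : rInv r π = Inv π := by
  refine filter_true_of_mem fun p _ => ?_
  have := (π p.1).2
  simp only [letter]
  omega

lemma rExcp_eq_empty (h : n < r) : rExcp r π = ∅ := by
  refine filter_eq_empty_iff.2 fun i _ hi => ?_
  have := (π i).2
  have := hi.2
  simp only [letter] at this
  omega

lemma excLevel_eq_zero (h : n < r) : excLevel r n π = 0 := by
  refine card_eq_zero.2 (filter_eq_empty_iff.2 fun i _ hi => ?_)
  have := i.2
  have := hi.2
  simp only [place] at this
  omega

lemma denLevel_eq_rmaj (h : n < r) : denLevel r n π = rmaj r n π := by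
  rw [denLevel, rmaj, rExcp_eq_empty π h, rDes_eq_empty π h.le, rInv_eq_Inv π h.le]
  simp [invAt]

lemma excLevel_eq_rdes (h : n < r) : excLevel r n π = rdes r n π := by
  rw [excLevel_eq_zero π h, rdes, rDes_eq_empty π h.le, card_empty]

end SmallSize

/-- The induction runs over all `t` at once, because the recursion calls on `tq`; this is why `t` is
an arbitrary ring element and not an indeterminate. -/
theorem sum_excLevel_denLevel_eq {K : Type*} [CommRing K] [IsDomain K] {q : K} (hq : q ≠ 1)
    (m n : ℕ) : ∀ t : K,
    ∑ π : Equiv.Perm (Fin n), t ^ excLevel (m + 1) n π * q ^ denLevel (m + 1) n π =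
      ∑ π : Equiv.Perm (Fin n), t ^ rdes (m + 1) n π * q ^ rmaj (m + 1) n π := by
  have small : ∀ n, n < m + 1 → ∀ t : K,
      ∑ π : Equiv.Perm (Fin n), t ^ excLevel (m + 1) n π * q ^ denLevel (m + 1) n π =
        ∑ π : Equiv.Perm (Fin n), t ^ rdes (m + 1) n π * q ^ rmaj (m + 1) n π :=
    fun n hn t => sum_congr rfl fun π _ => by rw [excLevel_eq_rdes π hn, denLevel_eq_rmaj π hn]
  rcases lt_or_ge n m with hn | hn
  · exact small n (by omega)
  induction n, hn using Nat.le_induction with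
  | base => exact small m (Nat.lt_succ_self m)
  | succ n hn ih =>
    intro t
    have h1 := heightSum_zero_recursion (q := q) hq n hn t
    simp only [heightSum_eq_sum_perm, ih] at h1
    rw [← sum_rdes_rmaj_recursion q t m hn] at h1
    exact mul_left_cancel₀ (sub_ne_zero.2 hq.symm) h1

theorem isREulerMahonian_excLevel_denLevel {r : ℕ} (hr : 1 ≤ r) :
    IsREulerMahonian r (excLevel r) (denLevel r) := by
  obtain ⟨m, rfl⟩ := Nat.exists_eq_add_of_le' hr
  intro n
  have hq : (X 1 : MvPolynomial (Fin 2) ℤ) ≠ 1 := fun h => by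
    simpa using congrArg (eval fun _ => (0 : ℤ)) h
  exact sum_excLevel_denLevel_eq hq m n (X 0)

/-! ### The case `r = 1`: the classical statistics. -/

section LevelOne

variable {n : ℕ} (π : Equiv.Perm (Fin n))

lemma rDes_one : rDes 1 π = Des π := rfl

lemma rInv_one : rInv 1 π = ∅ := by
  refine eq_empty_of_forall_notMem fun p hp => ?_
  obtain ⟨h, h'⟩ := mem_filter.1 hp
  have := (mem_filter.1 h).2.2
  omega

lemma rdes_one : rdes 1 = des := rfl

lemma rmaj_one : rmaj 1 = maj := by
  funext n π
  rw [rmaj, maj, rInv_one, rDes_one, card_empty, add_zero]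

lemma rExcp_one : rExcp 1 π = Excp π :=
  filter_congr fun _ _ => and_iff_left (Nat.succ_pos _)

lemma excLevel_one : excLevel 1 = exc := by
  funext n π
  rw [excLevel, exc, Excp]
  congr 1
  exact filter_congr fun _ _ => and_iff_left (Nat.succ_pos _)

lemma denLevel_one : denLevel 1 = den := by
  funext n π
  rw [denLevel, den, rExcp_one]

end LevelOne

end RawlingsDenert

theorem mainTheorem2 :
    (∀ r : ℕ, 1 ≤ r →
      RawlingsDenert.IsREulerMahonian r
        (RawlingsDenert.excLevel r) (RawlingsDenert.denLevel r)) ∧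
    RawlingsDenert.IsEulerMahonian RawlingsDenert.exc RawlingsDenert.den := by
  refine ⟨fun r hr => RawlingsDenert.isREulerMahonian_excLevel_denLevel hr, fun n => ?_⟩
  have h := RawlingsDenert.isREulerMahonian_excLevel_denLevel le_rfl n
  rwa [RawlingsDenert.excLevel_one, RawlingsDenert.denLevel_one, RawlingsDenert.rdes_one,
    RawlingsDenert.rmaj_one] at h
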